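/- There exists a constant $c_2>0$ such that the following holds. Let $n\ge 0$ be an even integer, let $\mathcal H=F_1\cup F_2$ be a finite set of lines in $\mathbb R^2$, where $F_1$ and $F_2$ are disjoint families with $|F_1|=|F_2|=\frac n2$, and let $B\subset\mathbb R^2$ be convex. Suppose that for every $(f,g)\in F_1\times F_2$ there is a point $p\in B$ with $B\cap f\cap g=\{p\}$. For a point $p$ let $a(p)$ be the number of lines of $\mathcal H$ that contain $p$, and let $F_{0,B}(\mathcal H)$ be the set of all points of $B$ that are the intersection of some lines of $\mathcal H$ (that is, the points of $B$ that lie on at least two distinct lines of $\mathcal H$). Then at least one of the following holds: (a) there is a point $p\in B$ with $a(p)\ge \frac{n}{100}$; (b) $|F_{0,B}(\mathcal H)|\ge c_2\, n^2$. -/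

import Mathlib

/-- The Euclidean space `ℝ^d`. -/
abbrev Space (d : ℕ) : Type := EuclideanSpace ℝ (Fin d)

/-- An affine hyperplane of `ℝ^d`: a non-empty affine subspace of dimension `d - 1`
(for `d = 2`, a line). -/
def IsAffineHyperplane {d : ℕ} (P : AffineSubspace ℝ (Space d)) : Prop :=
  (P : Set (Space d)).Nonempty ∧ Module.finrank ℝ P.direction + 1 = d

/-- A hyperplane arrangement: a finite set of affine hyperplanes of `ℝ^d`. -/
def IsArrangement {d : ℕ} (H : Finset (AffineSubspace ℝ (Space d))) : Prop :=
  ∀ P ∈ H, IsAffineHyperplane P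

/-- The flats of `H`: the non-empty intersections of hyperplanes from `H`. The whole space is a
flat, as the intersection of the empty subfamily. -/
def flats {d : ℕ} (H : Finset (AffineSubspace ℝ (Space d))) :
    Set (AffineSubspace ℝ (Space d)) :=
  {f | (f : Set (Space d)).Nonempty ∧
    ∃ A : Finset (AffineSubspace ℝ (Space d)), A ⊆ H ∧ f = sInf (A : Set _)}

/-- `F_{k,B}(H)`: the flats of `H` of dimension `k` that intersect `B`. -/
def flatsMeeting {d : ℕ} (H : Finset (AffineSubspace ℝ (Space d))) (k : ℕ)
    (B : Set (Space d)) : Set (AffineSubspace ℝ (Space d)) :=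
  {f | f ∈ flats H ∧ Module.finrank ℝ f.direction = k ∧ ((f : Set (Space d)) ∩ B).Nonempty}

/-- `a(s)`: the number of hyperplanes of `H` that contain `s`; for a point `p`, use `s = {p}`. -/
noncomputable def hyperplanesThrough {d : ℕ} (H : Finset (AffineSubspace ℝ (Space d)))
    (s : Set (Space d)) : ℕ :=
  {P | P ∈ H ∧ s ⊆ (P : Set (Space d))}.ncard

theorem flats_finite {d : ℕ} (H : Finset (AffineSubspace ℝ (Space d))) : (flats H).Finite := by
  refine (H.powerset.finite_toSet.image
    fun A : Finset (AffineSubspace ℝ (Space d)) => sInf (A : Set (AffineSubspace ℝ (Space d)))).subset ?_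
  rintro f ⟨-, A, hA, rfl⟩
  exact ⟨A, by simpa using hA, rfl⟩

/-- Hence the cardinality `Set.ncard` of the set of flats that meet `B` is the true one. -/
theorem flatsMeeting_finite {d : ℕ} (H : Finset (AffineSubspace ℝ (Space d))) (k : ℕ)
    (B : Set (Space d)) : (flatsMeeting H k B).Finite :=
  (flats_finite H).subset fun _ hf => hf.1

/-!
The convexity of `B` plays no role: the points where a line of `F₁` meets a line of `F₂` all lie in
`B`, and it is enough to count those. Let `P` be their set and `a p` the number of lines through
`p`. A point on `r` lines of `F₁` and `b` lines of `F₂` accounts for `r * b ≤ (a p) ^ 2 / 4` of the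
`n ^ 2 / 4` pairs, so the squares of the multiplicities add up to at least `n ^ 2`
(`four_mul_card_mul_card_le_sum_sq`).

If no multiplicity reaches `n / 100`, then the points of large multiplicity cannot account for this
sum. By a form of the Szemerédi–Trotter theorem (`IsArrangement.mul_card_le_of_rich`) at most
`2 * n / k + 128 * n ^ 2 / k ^ 3` points lie on `k` or more lines. Summed over `k` from `1024` to
`n / 100`, the first term contributes at most `n ^ 2 / 25` and the second at most `n ^ 2 / 4`
(`sum_sq_le_of_rich_bound`). The points of multiplicity at most `1024` have to supply the rest, so
there are quadratically many of them.

The incidence bound comes from the crossing inequality of Ajtai, Chvátal, Newborn, Szemerédi and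
Leighton, by Székely's method: the segments between consecutive points on the lines form a drawing
with at most `n ^ 2` crossings. Instead of Euler's formula, a direct argument shows that a
straight-line drawing on `v` points without crossings has at most `4 * v` segments
(`IsDrawing.card_le_of_not_crosses`). Let `t` be a segment that is not the lowest one leaving its
left endpoint, and `b` the segment just below it there. The wedge between `b` and `t` is closed by a
first point `w`, which is the right endpoint of `t`, the right endpoint of `b`, or an inner point,
and in each of the three cases `w` determines `t`. Random sampling of the points turns the linear
bound into the crossing inequality (`IsDrawing.sampled_card_le`).
-/

/-! ### Straight-line drawings without crossings -/

/-- A segment of a non-vertical line. The line `y = s * x + c` is encoded by the pair `(s, c)`, and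
the endpoints `left` and `right` are points `(x, y)`. -/
structure Seg where
  line : ℝ × ℝ
  left : ℝ × ℝ
  right : ℝ × ℝ

namespace Seg

/-- The height at abscissa `x` of the line that carries `e`. -/
def ht (e : Seg) (x : ℝ) : ℝ := e.line.1 * x + e.line.2

/-- The interiors of `e` and `f` meet, and `e` and `f` lie on different lines. -/
def Crosses (e f : Seg) : Prop :=
  e.line ≠ f.line ∧ ∃ x, e.left.1 < x ∧ x < e.right.1 ∧ f.left.1 < x ∧ x < f.right.1 ∧
    e.ht x = f.ht x

theorem continuous_ht (e : Seg) : Continuous e.ht := by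
  unfold ht; fun_prop

theorem line_eq_of_ht_eq {e f : Seg} {x y : ℝ} (hxy : x ≠ y) (hx : e.ht x = f.ht x)
    (hy : e.ht y = f.ht y) : e.line = f.line := by
  unfold ht at hx hy
  have h : (e.line.1 - f.line.1) * (x - y) = 0 := by linarith
  rcases mul_eq_zero.1 h with h | h
  · have h1 : e.line.1 = f.line.1 := by linarith
    refine Prod.ext h1 ?_
    rw [h1] at hx
    linarith
  · exact absurd (by linarith) hxy

theorem line_eq_of_slope_eq {e f : Seg} {x : ℝ} (hs : e.line.1 = f.line.1)
    (hx : e.ht x = f.ht x) : e.line = f.line := by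
  refine Prod.ext hs ?_
  unfold ht at hx
  rw [hs] at hx
  linarith

theorem slope_lt_of_ht_lt {e f : Seg} {a x : ℝ} (hax : a < x) (ha : e.ht a = f.ht a)
    (hx : e.ht x < f.ht x) : e.line.1 < f.line.1 := by
  unfold ht at ha hx
  have : 0 < (f.line.1 - e.line.1) * (x - a) := by linarith
  linarith [pos_of_mul_pos_left this (by linarith)]

theorem ht_lt_of_slope_lt_right {e f : Seg} {a x : ℝ} (hax : a < x) (ha : e.ht a = f.ht a)
    (hs : e.line.1 < f.line.1) : e.ht x < f.ht x := by
  unfold ht at ha ⊢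
  nlinarith [mul_pos (sub_pos.2 hax) (sub_pos.2 hs)]

theorem ht_lt_of_slope_lt_left {e f : Seg} {a x : ℝ} (hax : x < a) (ha : e.ht a = f.ht a)
    (hs : e.line.1 < f.line.1) : f.ht x < e.ht x := by
  unfold ht at ha ⊢
  nlinarith [mul_pos (sub_pos.2 hax) (sub_pos.2 hs)]

/-- Two segments that change their vertical order between `a` and `b`, on an interval inside both of
their ranges, cross. -/
theorem crosses_of_ht_lt {e f : Seg} {a b : ℝ} (hab : a < b) (ha : f.ht a < e.ht a)
    (hb : e.ht b < f.ht b) (hea : e.left.1 ≤ a) (heb : b ≤ e.right.1) (hfa : f.left.1 ≤ a)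
    (hfb : b ≤ f.right.1) : e.Crosses f := by
  have hc : ContinuousOn (fun x => f.ht x - e.ht x) (Set.Icc a b) :=
    (f.continuous_ht.sub e.continuous_ht).continuousOn
  obtain ⟨x, ⟨h1, h2⟩, h3⟩ := intermediate_value_Ioo hab.le hc
    (show (0 : ℝ) ∈ Set.Ioo _ _ from ⟨by linarith, by linarith⟩)
  refine ⟨?_, x, by linarith, by linarith, by linarith, by linarith, ?_⟩
  · intro h
    simp only [ht, h, lt_self_iff_false] at ha
  · have : f.ht x - e.ht x = 0 := h3
    linarith

end Seg

/-- The segments of `E` join points of `V` along lines, with no further point of `V` in the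
interior of a segment. No two points of `V` have the same abscissa. -/
structure IsDrawing (V : Finset (ℝ × ℝ)) (E : Finset Seg) : Prop where
  injOn : Set.InjOn Prod.fst (V : Set (ℝ × ℝ))
  left_mem : ∀ e ∈ E, e.left ∈ V
  right_mem : ∀ e ∈ E, e.right ∈ V
  left_lt_right : ∀ e ∈ E, e.left.1 < e.right.1
  ht_left : ∀ e ∈ E, e.ht e.left.1 = e.left.2
  ht_right : ∀ e ∈ E, e.ht e.right.1 = e.right.2
  empty : ∀ e ∈ E, ∀ w ∈ V, e.left.1 < w.1 → w.1 < e.right.1 → e.ht w.1 ≠ w.2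

/-- The segments `b` and `t` leave the same point to the right, `t` directly above `b`, and up to
the abscissa of `w` the closed wedge between them contains no point of `V` but their common left
endpoint. -/
structure IsWedge (V : Finset (ℝ × ℝ)) (E : Finset Seg) (b t : Seg) (w : ℝ × ℝ) : Prop where
  bot_mem : b ∈ E
  top_mem : t ∈ E
  left_eq : b.left = t.left
  slope_lt : b.line.1 < t.line.1
  next : ∀ f ∈ E, f.left = t.left → b.line.1 < f.line.1 → t.line.1 ≤ f.line.1
  left_lt : t.left.1 < w.1
  le_top : w.1 ≤ t.right.1
  le_bot : w.1 ≤ b.right.1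
  mem : w ∈ V
  empty : ∀ z ∈ V, t.left.1 < z.1 → z.1 < w.1 → b.ht z.1 ≤ z.2 → z.2 ≤ t.ht z.1 → False

namespace IsDrawing

variable {V : Finset (ℝ × ℝ)} {E : Finset Seg}

/-- Two segments of a drawing on the same line whose ranges overlap are equal. -/
theorem eq_of_line_eq (h : IsDrawing V E) {e f : Seg} (he : e ∈ E) (hf : f ∈ E)
    (hl : e.line = f.line) (h1 : e.left.1 < f.right.1) (h2 : f.left.1 < e.right.1) : e = f := by
  have hh : ∀ x, e.ht x = f.ht x := fun x => by simp [Seg.ht, hl]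
  have hleft : e.left = f.left := by
    refine h.injOn (h.left_mem e he) (h.left_mem f hf) ?_
    rcases lt_trichotomy e.left.1 f.left.1 with h3 | h3 | h3
    · exact absurd ((hh _).trans (h.ht_left f hf)) (h.empty e he _ (h.left_mem f hf) h3 h2)
    · exact h3
    · exact absurd ((hh _).symm.trans (h.ht_left e he)) (h.empty f hf _ (h.left_mem e he) h3 h1)
  have hright : e.right = f.right := by
    refine h.injOn (h.right_mem e he) (h.right_mem f hf) ?_
    rcases lt_trichotomy e.right.1 f.right.1 with h3 | h3 | h3
    · exact absurd ((hh _).symm.trans (h.ht_right e he))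
        (h.empty f hf _ (h.right_mem e he) h2 h3)
    · exact h3
    · exact absurd ((hh _).trans (h.ht_right f hf)) (h.empty e he _ (h.right_mem f hf) h1 h3)
  cases e; cases f; simp_all

/-- In a drawing without crossings, no segment that reaches the abscissa of `w` runs inside a
wedge of `w` shortly before: followed to the left it can neither end in the wedge nor leave it, so
it starts at the apex of the wedge, between two adjacent segments. -/
theorem not_between (h : IsDrawing V E) (hE : ∀ e ∈ E, ∀ f ∈ E, ¬ e.Crosses f)
    {b t f : Seg} {w : ℝ × ℝ} (hw : IsWedge V E b t w) (hf : f ∈ E) (hfl : f.left.1 < w.1)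
    (hfr : w.1 ≤ f.right.1)
    (hev : ∀ᶠ x in nhdsWithin w.1 (Set.Iio w.1), b.ht x < f.ht x ∧ f.ht x < t.ht x) : False := by
  have hbl : b.left.1 = t.left.1 := by rw [hw.left_eq]
  have hmax : max t.left.1 f.left.1 < w.1 := max_lt hw.left_lt hfl
  obtain ⟨x, ⟨hbx, htx⟩, hax, hxw⟩ := (hev.and (Ioo_mem_nhdsLT hmax)).exists
  have hta := le_max_left t.left.1 f.left.1
  have hfa := le_max_right t.left.1 f.left.1
  set a := max t.left.1 f.left.1 with ha
  have htop : f.ht a ≤ t.ht a := by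
    by_contra! hc
    exact hE f hf t hw.top_mem (Seg.crosses_of_ht_lt hax hc htx hfa (by linarith) hta
      (by linarith [hw.le_top]))
  have hbot : b.ht a ≤ f.ht a := by
    by_contra! hc
    exact hE b hw.bot_mem f hf (Seg.crosses_of_ht_lt hax hc hbx (by linarith)
      (by linarith [hw.le_bot]) hfa (by linarith))
  rcases lt_or_ge t.left.1 f.left.1 with hlt | hge
  · have haf : a = f.left.1 := max_eq_right hlt.le
    rw [haf, h.ht_left f hf] at htop hbot
    exact hw.empty _ (h.left_mem f hf) hlt hfl hbot htop
  · have hat : a = t.left.1 := max_eq_left hge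
    have hbt : b.ht t.left.1 = t.left.2 := by rw [← hw.left_eq, h.ht_left b hw.bot_mem]
    rw [hat, h.ht_left t hw.top_mem] at htop
    rw [hat, hbt] at hbot
    have hft : f.ht t.left.1 = t.left.2 := le_antisymm htop hbot
    rcases hge.lt_or_eq with hlt | heq
    · exact h.empty f hf _ (h.left_mem t hw.top_mem) hlt (by linarith [hw.left_lt]) hft
    · have hfe : f.left = t.left := h.injOn (h.left_mem f hf) (h.left_mem t hw.top_mem) heq
      have h1 : b.line.1 < f.line.1 :=
        Seg.slope_lt_of_ht_lt (a := t.left.1) (by linarith) (hbt.trans hft.symm) hbx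
      have h2 : f.line.1 < t.line.1 :=
        Seg.slope_lt_of_ht_lt (a := t.left.1) (by linarith)
          (hft.trans (h.ht_left t hw.top_mem).symm) htx
      exact absurd (hw.next f hf hfe h1) (not_le.2 h2)

theorem exists_isWedge (h : IsDrawing V E) {t : Seg} (ht : t ∈ E)
    (hlow : ∃ f ∈ E, f.left = t.left ∧ f.line.1 < t.line.1) :
    ∃ b w, IsWedge V E b t w ∧ b.ht w.1 ≤ w.2 ∧ w.2 ≤ t.ht w.1 := by
  classical
  obtain ⟨f, hf, hfl, hfs⟩ := hlow
  obtain ⟨b, hb, hbmax⟩ := (E.filter fun f => f.left = t.left ∧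
    f.line.1 < t.line.1).exists_max_image (fun f => f.line.1) ⟨f, by simp [hf, hfl, hfs]⟩
  simp only [Finset.mem_filter] at hb hbmax
  obtain ⟨hb, hbl, hbs⟩ := hb
  have hbt : b.ht t.left.1 = t.ht t.left.1 := by
    rw [h.ht_left t ht, ← hbl, h.ht_left b hb]
  have hlt : ∀ x, t.left.1 < x → b.ht x < t.ht x := fun x hx =>
    Seg.ht_lt_of_slope_lt_right hx hbt hbs
  have htr := h.left_lt_right t ht
  have hbr := h.left_lt_right b hb
  rw [hbl] at hbr
  have hne : (V.filter fun z => t.left.1 < z.1 ∧ z.1 ≤ t.right.1 ∧ z.1 ≤ b.right.1 ∧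
      b.ht z.1 ≤ z.2 ∧ z.2 ≤ t.ht z.1).Nonempty := by
    rcases le_total t.right.1 b.right.1 with hle | hle
    · refine ⟨t.right, Finset.mem_filter.2 ⟨h.right_mem t ht, htr, le_rfl, hle, ?_, ?_⟩⟩
      · rw [← h.ht_right t ht]; exact (hlt _ htr).le
      · rw [h.ht_right t ht]
    · refine ⟨b.right, Finset.mem_filter.2 ⟨h.right_mem b hb, hbr, hle, le_rfl, ?_, ?_⟩⟩
      · rw [h.ht_right b hb]
      · rw [← h.ht_right b hb]; exact (hlt _ hbr).le
  obtain ⟨w, hw, hwmin⟩ := Finset.exists_min_image _ Prod.fst hne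
  simp only [Finset.mem_filter] at hw hwmin
  obtain ⟨hwV, hw1, hw2, hw3, hw4, hw5⟩ := hw
  refine ⟨b, w, ⟨hb, ht, hbl, hbs, ?_, hw1, hw2, hw3, hwV, ?_⟩, hw4, hw5⟩
  · intro g hg hgl hgs
    by_contra! hc
    exact absurd (hbmax g ⟨hg, hgl, hc⟩) (not_le.2 hgs)
  · intro z hz hz1 hz2 hz3 hz4
    exact absurd (hwmin z ⟨hz, hz1, by linarith, by linarith, hz3, hz4⟩) (not_le.2 hz2)

/-- A wedge closed by the right endpoint of its upper segment is determined by that point: the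
upper segment is the steepest one that ends there. -/
theorem top_eq_of_right (h : IsDrawing V E) (hE : ∀ e ∈ E, ∀ f ∈ E, ¬ e.Crosses f)
    {b t b' t' : Seg} {w : ℝ × ℝ} (hw : IsWedge V E b t w) (hw' : IsWedge V E b' t' w)
    (hr : t.ht w.1 = w.2) (hr' : t'.ht w.1 = w.2) : t = t' := by
  have key : ∀ {b t b' t' : Seg}, IsWedge V E b t w → IsWedge V E b' t' w →
      t.ht w.1 = w.2 → t'.ht w.1 = w.2 → t'.line.1 ≤ t.line.1 := by
    intro b t b' t' hw hw' hr hr'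
    by_contra! hc
    refine h.not_between hE hw hw'.top_mem hw'.left_lt hw'.le_top ?_
    have hbt : b.ht w.1 < t'.ht w.1 := by
      rw [hr', ← hr]
      refine Seg.ht_lt_of_slope_lt_right hw.left_lt ?_ hw.slope_lt
      rw [h.ht_left t hw.top_mem, ← hw.left_eq, h.ht_left b hw.bot_mem]
    have hev : ∀ᶠ x in nhds w.1, b.ht x < t'.ht x :=
      b.continuous_ht.continuousAt.eventually_lt t'.continuous_ht.continuousAt hbt
    filter_upwards [hev.filter_mono nhdsWithin_le_nhds, self_mem_nhdsWithin] with x hx1 hx2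
    exact ⟨hx1, Seg.ht_lt_of_slope_lt_left hx2 (hr.trans hr'.symm) hc⟩
  have hs := le_antisymm (key hw' hw hr' hr) (key hw hw' hr hr')
  exact h.eq_of_line_eq hw.top_mem hw'.top_mem
    (Seg.line_eq_of_slope_eq hs (hr.trans hr'.symm))
    (hw.left_lt.trans_le hw'.le_top) (hw'.left_lt.trans_le hw.le_top)

/-- A wedge closed by the right endpoint of its lower segment is determined by that point: the
lower segment is the least steep one that ends there, and the upper one is its successor. -/
theorem top_eq_of_right_bot (h : IsDrawing V E) (hE : ∀ e ∈ E, ∀ f ∈ E, ¬ e.Crosses f)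
    {b t b' t' : Seg} {w : ℝ × ℝ} (hw : IsWedge V E b t w) (hw' : IsWedge V E b' t' w)
    (hr : b.ht w.1 = w.2) (hr' : b'.ht w.1 = w.2) : t = t' := by
  have hbl : ∀ {b t : Seg}, IsWedge V E b t w → b.left.1 < w.1 := by
    intro b t hw
    rw [hw.left_eq]; exact hw.left_lt
  have key : ∀ {b t b' t' : Seg}, IsWedge V E b t w → IsWedge V E b' t' w →
      b.ht w.1 = w.2 → b'.ht w.1 = w.2 → b.line.1 ≤ b'.line.1 := by
    intro b t b' t' hw hw' hr hr'
    by_contra! hc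
    refine h.not_between hE hw hw'.bot_mem (hbl hw') hw'.le_bot ?_
    have hbt : b'.ht w.1 < t.ht w.1 := by
      rw [hr', ← hr]
      refine Seg.ht_lt_of_slope_lt_right hw.left_lt ?_ hw.slope_lt
      rw [h.ht_left t hw.top_mem, ← hw.left_eq, h.ht_left b hw.bot_mem]
    have hev : ∀ᶠ x in nhds w.1, b'.ht x < t.ht x :=
      b'.continuous_ht.continuousAt.eventually_lt t.continuous_ht.continuousAt hbt
    filter_upwards [hev.filter_mono nhdsWithin_le_nhds, self_mem_nhdsWithin] with x hx1 hx2
    exact ⟨Seg.ht_lt_of_slope_lt_left hx2 (hr'.trans hr.symm) hc, hx1⟩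
  have hs := le_antisymm (key hw hw' hr hr') (key hw' hw hr' hr)
  have hb : b = b' := h.eq_of_line_eq hw.bot_mem hw'.bot_mem
    (Seg.line_eq_of_slope_eq hs (hr.trans hr'.symm))
    ((hbl hw).trans_le hw'.le_bot) ((hbl hw').trans_le hw.le_bot)
  subst hb
  have hl : t.left = t'.left := hw.left_eq.symm.trans hw'.left_eq
  have hst : t.line.1 = t'.line.1 :=
    le_antisymm (hw.next _ hw'.top_mem hl.symm hw'.slope_lt)
      (hw'.next _ hw.top_mem hl hw.slope_lt)
  refine h.eq_of_line_eq hw.top_mem hw'.top_mem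
    (Seg.line_eq_of_slope_eq (x := t.left.1) hst ?_)
    (hw.left_lt.trans_le hw'.le_top) (hw'.left_lt.trans_le hw.le_top)
  rw [h.ht_left t hw.top_mem, hl, h.ht_left t' hw'.top_mem]

/-- A wedge closed by a point strictly inside is determined by that point: the upper segment is the
first one above the point. -/
theorem top_eq_of_inside (h : IsDrawing V E) (hE : ∀ e ∈ E, ∀ f ∈ E, ¬ e.Crosses f)
    {b t b' t' : Seg} {w : ℝ × ℝ} (hw : IsWedge V E b t w) (hw' : IsWedge V E b' t' w)
    (hb : b.ht w.1 < w.2) (ht : w.2 < t.ht w.1) (hb' : b'.ht w.1 < w.2)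
    (ht' : w.2 < t'.ht w.1) : t = t' := by
  have key : ∀ {b t b' t' : Seg}, IsWedge V E b t w → IsWedge V E b' t' w →
      b.ht w.1 < w.2 → w.2 < t'.ht w.1 → t.ht w.1 ≤ t'.ht w.1 := by
    intro b t b' t' hw hw' hb ht'
    by_contra! hc
    refine h.not_between hE hw hw'.top_mem hw'.left_lt hw'.le_top ?_
    have h1 := b.continuous_ht.continuousAt.eventually_lt t'.continuous_ht.continuousAt
      (hb.trans ht')
    have h2 := t'.continuous_ht.continuousAt.eventually_lt t.continuous_ht.continuousAt hc
    exact (h1.and h2).filter_mono nhdsWithin_le_nhds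
  have key2 : ∀ {b t : Seg}, IsWedge V E b t w → w.2 < t.ht w.1 → w.1 < t.right.1 := by
    intro b t hw ht
    refine lt_of_le_of_ne hw.le_top fun heq => ?_
    have := h.injOn hw.mem (h.right_mem t hw.top_mem) heq
    rw [this, h.ht_right t hw.top_mem] at ht
    exact lt_irrefl _ ht
  have heq := le_antisymm (key hw hw' hb ht') (key hw' hw hb' ht)
  refine h.eq_of_line_eq hw.top_mem hw'.top_mem ?_
    (hw.left_lt.trans_le hw'.le_top) (hw'.left_lt.trans_le hw.le_top)
  by_contra hl
  exact hE t hw.top_mem t' hw'.top_mem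
    ⟨hl, w.1, hw.left_lt, key2 hw ht, hw'.left_lt, key2 hw' ht', heq⟩

/-- A straight-line drawing without crossings has linearly many segments. Each segment is the
lowest one leaving its left endpoint, or the upper side of a wedge, and the wedge is charged to the
first point that closes it. -/
theorem card_le_of_not_crosses (h : IsDrawing V E) (hE : ∀ e ∈ E, ∀ f ∈ E, ¬ e.Crosses f) :
    E.card ≤ 4 * V.card := by
  classical
  set E₀ := E.filter fun t => ∀ f ∈ E, f.left = t.left → t.line.1 ≤ f.line.1 with hE₀
  set E₁ := E.filter fun t => ∃ b w, IsWedge V E b t w ∧ t.ht w.1 = w.2 with hE₁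
  set E₂ := E.filter fun t => ∃ b w, IsWedge V E b t w ∧ b.ht w.1 = w.2 with hE₂
  set E₃ := E.filter fun t => ∃ b w, IsWedge V E b t w ∧ b.ht w.1 < w.2 ∧ w.2 < t.ht w.1 with hE₃
  have hsub : E ⊆ E₀ ∪ E₁ ∪ (E₂ ∪ E₃) := by
    intro t ht
    by_cases hlow : ∃ f ∈ E, f.left = t.left ∧ f.line.1 < t.line.1
    · obtain ⟨b, w, hw, h1, h2⟩ := h.exists_isWedge ht hlow
      rcases h2.eq_or_lt with h2 | h2
      · simp only [Finset.mem_union, hE₁, Finset.mem_filter]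
        exact Or.inl (Or.inr ⟨ht, b, w, hw, h2.symm⟩)
      rcases h1.eq_or_lt with h1 | h1
      · simp only [Finset.mem_union, hE₂, Finset.mem_filter]
        exact Or.inr (Or.inl ⟨ht, b, w, hw, h1⟩)
      · simp only [Finset.mem_union, hE₃, Finset.mem_filter]
        exact Or.inr (Or.inr ⟨ht, b, w, hw, h1, h2⟩)
    · push Not at hlow
      simp only [Finset.mem_union, hE₀, Finset.mem_filter]
      exact Or.inl (Or.inl ⟨ht, hlow⟩)
  have c₀ : E₀.card ≤ V.card := by
    refine Finset.card_le_card_of_injOn Seg.left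
      (fun t ht => h.left_mem t (Finset.mem_filter.1 ht).1) ?_
    intro t ht t' ht' heq
    obtain ⟨ht, hmin⟩ := Finset.mem_filter.1 ht
    obtain ⟨ht', hmin'⟩ := Finset.mem_filter.1 ht'
    have hs := le_antisymm (hmin t' ht' heq.symm) (hmin' t ht heq)
    refine h.eq_of_line_eq ht ht' (Seg.line_eq_of_slope_eq (x := t.left.1) hs ?_) ?_ ?_
    · rw [h.ht_left t ht, heq, h.ht_left t' ht']
    · rw [heq]; exact h.left_lt_right t' ht'
    · rw [← heq]; exact h.left_lt_right t ht
  have c₁ : E₁.card ≤ V.card := by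
    refine Finset.card_le_card_of_forall_subsingleton
      (fun t w => ∃ b, IsWedge V E b t w ∧ t.ht w.1 = w.2) ?_ ?_
    · intro t ht
      obtain ⟨-, b, w, hw, h1⟩ := Finset.mem_filter.1 ht
      exact ⟨w, hw.mem, b, hw, h1⟩
    · rintro w - t ⟨-, b, hw, h1⟩ t' ⟨-, b', hw', h1'⟩
      exact h.top_eq_of_right hE hw hw' h1 h1'
  have c₂ : E₂.card ≤ V.card := by
    refine Finset.card_le_card_of_forall_subsingleton
      (fun t w => ∃ b, IsWedge V E b t w ∧ b.ht w.1 = w.2) ?_ ?_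
    · intro t ht
      obtain ⟨-, b, w, hw, h1⟩ := Finset.mem_filter.1 ht
      exact ⟨w, hw.mem, b, hw, h1⟩
    · rintro w - t ⟨-, b, hw, h1⟩ t' ⟨-, b', hw', h1'⟩
      exact h.top_eq_of_right_bot hE hw hw' h1 h1'
  have c₃ : E₃.card ≤ V.card := by
    refine Finset.card_le_card_of_forall_subsingleton
      (fun t w => ∃ b, IsWedge V E b t w ∧ b.ht w.1 < w.2 ∧ w.2 < t.ht w.1) ?_ ?_
    · intro t ht
      obtain ⟨-, b, w, hw, h1, h2⟩ := Finset.mem_filter.1 ht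
      exact ⟨w, hw.mem, b, hw, h1, h2⟩
    · rintro w - t ⟨-, b, hw, h1, h2⟩ t' ⟨-, b', hw', h1', h2'⟩
      exact h.top_eq_of_inside hE hw hw' h1 h2 h1' h2'
  have := Finset.card_le_card hsub
  have := Finset.card_union_le (E₀ ∪ E₁) (E₂ ∪ E₃)
  have := Finset.card_union_le E₀ E₁
  have := Finset.card_union_le E₂ E₃
  omega

end IsDrawing

/-! ### The crossing inequality by random sampling -/

/-- Choose a random subset `Q` of `P` by keeping each element independently with probability `q`:
each `a ∈ A` has probability `q ^ j` that `T a ⊆ Q`, where `j` is the cardinality of `T a`. -/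
theorem sum_powerset_weight_mul_card {α β : Type*} [DecidableEq α] (P : Finset α) (q : ℝ)
    (A : Finset β) (T : β → Finset α) (hT : ∀ a ∈ A, T a ⊆ P) {j : ℕ}
    (hj : ∀ a ∈ A, (T a).card = j) :
    ∑ Q ∈ P.powerset, q ^ Q.card * (1 - q) ^ (P \ Q).card * ((A.filter fun a => T a ⊆ Q).card : ℝ)
      = q ^ j * A.card := by
  simp_rw [Finset.card_filter, Nat.cast_sum, Finset.mul_sum]
  rw [Finset.sum_comm, mul_comm, ← nsmul_eq_mul]
  refine Finset.sum_eq_card_nsmul fun a ha => ?_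
  rw [← hj a ha]
  have hprod := Finset.prod_add (fun _ : α => q) (fun i => if i ∈ T a then (0 : ℝ) else 1 - q) P
  have hleft : ∏ i ∈ P, (q + if i ∈ T a then 0 else 1 - q) = q ^ (T a).card := by
    have : ∀ i ∈ P, (q + if i ∈ T a then 0 else 1 - q) = if i ∈ T a then q else 1 := by
      intro i _; split_ifs <;> ring
    rw [Finset.prod_congr rfl this, Finset.prod_ite, Finset.prod_const, Finset.prod_const_one,
      mul_one, Finset.filter_mem_eq_inter, Finset.inter_eq_right.2 (hT a ha)]
  rw [← hleft, hprod]
  refine Finset.sum_congr rfl fun Q hQ => ?_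
  rw [Finset.prod_const, mul_assoc]
  congr 1
  by_cases hTQ : T a ⊆ Q
  · rw [if_pos hTQ, Finset.prod_congr rfl (g := fun _ => 1 - q), Finset.prod_const]
    · simp
    · intro i hi
      rw [if_neg fun h => (Finset.mem_sdiff.1 hi).2 (hTQ h)]
  · rw [if_neg hTQ]
    obtain ⟨i, hi, hiQ⟩ := Finset.not_subset.1 hTQ
    have hzero : ∏ i ∈ P \ Q, (if i ∈ T a then (0 : ℝ) else 1 - q) = 0 :=
      Finset.prod_eq_zero (Finset.mem_sdiff.2 ⟨hT a ha hi, hiQ⟩) (if_pos hi)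
    rw [hzero, Nat.cast_zero, mul_zero]

open Classical in
/-- The ordered pairs of crossing segments of `E`. -/
noncomputable def crossings (E : Finset Seg) : Finset (Seg × Seg) :=
  (E ×ˢ E).filter fun z => z.1.Crosses z.2

theorem mem_crossings {E : Finset Seg} {z : Seg × Seg} :
    z ∈ crossings E ↔ z.1 ∈ E ∧ z.2 ∈ E ∧ z.1.Crosses z.2 := by
  classical
  simp [crossings, and_assoc]

namespace IsDrawing

variable {V : Finset (ℝ × ℝ)} {E : Finset Seg}

theorem mono (h : IsDrawing V E) {V' : Finset (ℝ × ℝ)} {E' : Finset Seg} (hV : V' ⊆ V)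
    (hE : E' ⊆ E) (hl : ∀ e ∈ E', e.left ∈ V') (hr : ∀ e ∈ E', e.right ∈ V') :
    IsDrawing V' E' where
  injOn := h.injOn.mono (by exact_mod_cast hV)
  left_mem := hl
  right_mem := hr
  left_lt_right e he := h.left_lt_right e (hE he)
  ht_left e he := h.ht_left e (hE he)
  ht_right e he := h.ht_right e (hE he)
  empty e he w hw := h.empty e (hE he) w (hV hw)

/-- Deleting all segments that take part in a crossing leaves a drawing without crossings. -/
theorem card_le_add_crossings (h : IsDrawing V E) :
    E.card ≤ 4 * V.card + (crossings E).card := by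
  classical
  set E' := E.filter fun e => ∀ f ∈ E, ¬ e.Crosses f with hE'
  have hsub : E' ⊆ E := Finset.filter_subset _ _
  have h1 : E'.card ≤ 4 * V.card := by
    refine (h.mono subset_rfl hsub (fun e he => h.left_mem e (hsub he))
      (fun e he => h.right_mem e (hsub he))).card_le_of_not_crosses ?_
    intro e he f hf
    exact (Finset.mem_filter.1 he).2 f (hsub hf)
  have h2 : E ⊆ E' ∪ (crossings E).image Prod.fst := by
    intro e he
    by_cases hc : ∀ f ∈ E, ¬ e.Crosses f
    · exact Finset.mem_union_left _ (Finset.mem_filter.2 ⟨he, hc⟩)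
    · push Not at hc
      obtain ⟨f, hf, hef⟩ := hc
      exact Finset.mem_union_right _
        (Finset.mem_image.2 ⟨(e, f), mem_crossings.2 ⟨he, hf, hef⟩, rfl⟩)
  have h3 := Finset.card_le_card h2
  have h4 := Finset.card_union_le E' ((crossings E).image Prod.fst)
  have h5 := Finset.card_image_le (s := crossings E) (f := Prod.fst)
  omega

theorem card_endpoints [DecidableEq (ℝ × ℝ)] (h : IsDrawing V E) {e : Seg} (he : e ∈ E) :
    ({e.left, e.right} : Finset (ℝ × ℝ)).card = 2 := by
  refine Finset.card_pair fun heq => ?_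
  have := h.left_lt_right e he
  rw [heq] at this
  exact lt_irrefl _ this

/-- Crossing segments lie on different lines that meet in the interiors, so they share no
endpoint. -/
theorem card_endpoints_of_crosses [DecidableEq (ℝ × ℝ)] (h : IsDrawing V E) {e f : Seg}
    (he : e ∈ E) (hf : f ∈ E) (hc : e.Crosses f) :
    ({e.left, e.right} ∪ {f.left, f.right} : Finset (ℝ × ℝ)).card = 4 := by
  obtain ⟨hl, x, h1, h2, h3, h4, h5⟩ := hc
  have key : ∀ a : ℝ × ℝ, a.1 ≠ x → e.ht a.1 = a.2 → f.ht a.1 = a.2 → False :=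
    fun a hax hea hfa => hl (Seg.line_eq_of_ht_eq hax (hea.trans hfa.symm) h5)
  rw [Finset.card_union_of_disjoint, h.card_endpoints he, h.card_endpoints hf]
  rw [Finset.disjoint_left]
  intro a hae haf
  simp only [Finset.mem_insert, Finset.mem_singleton] at hae haf
  refine key a ?_ ?_ ?_
  · rcases hae with rfl | rfl
    · exact h1.ne
    · exact h2.ne'
  · rcases hae with rfl | rfl
    · exact h.ht_left e he
    · exact h.ht_right e he
  · rcases haf with rfl | rfl
    · exact h.ht_left f hf
    · exact h.ht_right f hf

/-- The crossing inequality, with a sampling probability `q` that is still to be chosen. -/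
theorem sampled_card_le (h : IsDrawing V E) {q : ℝ} (hq : 0 ≤ q) (hq1 : q ≤ 1) :
    q ^ 2 * (E.card : ℝ) ≤ 4 * (q * V.card) + q ^ 4 * (crossings E).card := by
  classical
  have hE := sum_powerset_weight_mul_card V q E (fun e => {e.left, e.right}) (by
    intro e he
    simp [Finset.insert_subset_iff, h.left_mem e he, h.right_mem e he])
    (fun e he => h.card_endpoints he)
  have hV := sum_powerset_weight_mul_card V q V (fun v => {v}) (by simp) (j := 1) (by simp)
  have hC := sum_powerset_weight_mul_card V q (crossings E)
    (fun z => {z.1.left, z.1.right} ∪ {z.2.left, z.2.right}) (by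
    intro z hz
    obtain ⟨h1, h2, -⟩ := mem_crossings.1 hz
    simp [Finset.insert_subset_iff, h.left_mem _ h1, h.right_mem _ h1, h.left_mem _ h2,
      h.right_mem _ h2])
    (fun z hz => by
      obtain ⟨h1, h2, h3⟩ := mem_crossings.1 hz
      exact h.card_endpoints_of_crosses h1 h2 h3)
  rw [pow_one] at hV
  rw [← hE, ← hV, ← hC, Finset.mul_sum,
    ← Finset.sum_add_distrib]
  refine Finset.sum_le_sum fun Q hQ => ?_
  have hQV := Finset.mem_powerset.1 hQ
  set EQ := E.filter fun e => ({e.left, e.right} : Finset (ℝ × ℝ)) ⊆ Q with hEQ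
  have hEQm : ∀ e ∈ EQ, e ∈ E ∧ e.left ∈ Q ∧ e.right ∈ Q := by
    intro e he
    simpa [hEQ, Finset.insert_subset_iff] using he
  have hdraw : IsDrawing Q EQ := h.mono hQV (Finset.filter_subset _ _)
    (fun e he => (hEQm e he).2.1) (fun e he => (hEQm e he).2.2)
  have hle := hdraw.card_le_add_crossings
  have hV' : (V.filter fun v => ({v} : Finset (ℝ × ℝ)) ⊆ Q).card = Q.card := by
    congr 1
    ext v
    simp only [Finset.mem_filter, Finset.singleton_subset_iff]
    exact ⟨fun h => h.2, fun h => ⟨hQV h, h⟩⟩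
  have hC' : (crossings EQ).card ≤ ((crossings E).filter fun z =>
      ({z.1.left, z.1.right} ∪ {z.2.left, z.2.right} : Finset (ℝ × ℝ)) ⊆ Q).card := by
    refine Finset.card_le_card fun z hz => ?_
    obtain ⟨h1, h2, h3⟩ := mem_crossings.1 hz
    refine Finset.mem_filter.2
      ⟨mem_crossings.2 ⟨(hEQm _ h1).1, (hEQm _ h2).1, h3⟩, Finset.union_subset ?_ ?_⟩
    · exact (Finset.mem_filter.1 h1).2
    · exact (Finset.mem_filter.1 h2).2
  rw [hV']
  have hcast : (EQ.card : ℝ) ≤ 4 * (Q.card : ℝ) + (((crossings E).filter fun z =>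
      ({z.1.left, z.1.right} ∪ {z.2.left, z.2.right} : Finset (ℝ × ℝ)) ⊆ Q).card : ℝ) := by
    exact_mod_cast hle.trans (by omega)
  have hw : 0 ≤ q ^ Q.card * (1 - q) ^ (V \ Q).card :=
    mul_nonneg (pow_nonneg hq _) (pow_nonneg (by linarith) _)
  calc _ ≤ _ := mul_le_mul_of_nonneg_left hcast hw
    _ = _ := by ring

end IsDrawing

/-! ### Incidences of points and lines -/

open Classical in
/-- The segments between consecutive points of `P` on the lines of `L`. -/
noncomputable def consecutive (P L : Finset (ℝ × ℝ)) : Finset Seg :=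
  ((L ×ˢ (P ×ˢ P)).image fun z => Seg.mk z.1 z.2.1 z.2.2).filter fun e =>
    e.ht e.left.1 = e.left.2 ∧ e.ht e.right.1 = e.right.2 ∧ e.left.1 < e.right.1 ∧
      ∀ w ∈ P, e.left.1 < w.1 → w.1 < e.right.1 → e.ht w.1 ≠ w.2

theorem mem_consecutive {P L : Finset (ℝ × ℝ)} {e : Seg} :
    e ∈ consecutive P L ↔ (e.line ∈ L ∧ e.left ∈ P ∧ e.right ∈ P) ∧
      e.ht e.left.1 = e.left.2 ∧ e.ht e.right.1 = e.right.2 ∧ e.left.1 < e.right.1 ∧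
      ∀ w ∈ P, e.left.1 < w.1 → w.1 < e.right.1 → e.ht w.1 ≠ w.2 := by
  classical
  unfold consecutive
  rw [Finset.mem_filter]
  refine and_congr_left fun _ => ?_
  simp only [Finset.mem_image, Finset.mem_product, Prod.exists]
  constructor
  · rintro ⟨a, b, c, d, f, g, h, rfl⟩
    exact h
  · intro h
    exact ⟨_, _, _, _, _, _, h, rfl⟩

theorem isDrawing_consecutive {P : Finset (ℝ × ℝ)} (L : Finset (ℝ × ℝ))
    (hP : Set.InjOn Prod.fst (P : Set (ℝ × ℝ))) : IsDrawing P (consecutive P L) where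
  injOn := hP
  left_mem _ he := (mem_consecutive.1 he).1.2.1
  right_mem _ he := (mem_consecutive.1 he).1.2.2
  left_lt_right _ he := (mem_consecutive.1 he).2.2.2.1
  ht_left _ he := (mem_consecutive.1 he).2.1
  ht_right _ he := (mem_consecutive.1 he).2.2.1
  empty _ he := (mem_consecutive.1 he).2.2.2.2

/-- Two lines cross at most once, so there are at most as many crossings as pairs of lines. -/
theorem card_crossings_consecutive_le {P : Finset (ℝ × ℝ)} (L : Finset (ℝ × ℝ))
    (hP : Set.InjOn Prod.fst (P : Set (ℝ × ℝ))) :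
    (crossings (consecutive P L)).card ≤ L.card ^ 2 := by
  have hd := isDrawing_consecutive L hP
  rw [sq, ← Finset.card_product]
  refine Finset.card_le_card_of_injOn (fun z => (z.1.line, z.2.line)) ?_ ?_
  · intro z hz
    obtain ⟨h1, h2, -⟩ := mem_crossings.1 hz
    exact Finset.mem_coe.2 (Finset.mem_product.2
      ⟨(mem_consecutive.1 h1).1.1, (mem_consecutive.1 h2).1.1⟩)
  · rintro ⟨e, f⟩ hz ⟨e', f'⟩ hz' heq
    obtain ⟨he, hf, hl, x, h1, h2, h3, h4, h5⟩ := mem_crossings.1 hz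
    obtain ⟨he', hf', -, x', h1', h2', h3', h4', h5'⟩ := mem_crossings.1 hz'
    obtain ⟨hle, hlf⟩ := Prod.mk.inj heq
    dsimp only at *
    have hx : x = x' := by
      by_contra hne
      refine hl (Seg.line_eq_of_ht_eq hne h5 ?_)
      simpa only [Seg.ht, hle, hlf] using h5'
    subst hx
    rw [hd.eq_of_line_eq he he' hle (h1.trans h2') (h1'.trans h2),
      hd.eq_of_line_eq hf hf' hlf (h3.trans h4') (h3'.trans h4)]

/-- On each line, every incident point but the last starts a segment. -/
theorem sum_card_filter_le_card_consecutive {P : Finset (ℝ × ℝ)} (L : Finset (ℝ × ℝ))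
    (hP : Set.InjOn Prod.fst (P : Set (ℝ × ℝ))) :
    ∑ p ∈ P, (L.filter fun l => l.1 * p.1 + l.2 = p.2).card ≤
      (consecutive P L).card + L.card := by
  classical
  set I := (P ×ˢ L).filter fun z => z.2.1 * z.1.1 + z.2.2 = z.1.2 with hI
  have hcard : ∑ p ∈ P, (L.filter fun l => l.1 * p.1 + l.2 = p.2).card = I.card := by
    rw [hI, Finset.card_filter, Finset.sum_product]
    exact Finset.sum_congr rfl fun p _ => Finset.card_filter _ _
  rw [hcard]
  set J := (consecutive P L).image fun e => (e.left, e.line) with hJ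
  have h1 : J.card ≤ (consecutive P L).card := Finset.card_image_le
  have h2 : (I \ J).card ≤ L.card := by
    refine Finset.card_le_card_of_injOn Prod.snd ?_ ?_
    · intro z hz
      have := (Finset.mem_sdiff.1 hz).1
      exact (Finset.mem_product.1 (Finset.mem_filter.1 this).1).2
    · -- If two points on the same line were not the start of a segment, the left one would
      -- have a successor.
      have key : ∀ p p' l, (p, l) ∈ I \ J → (p', l) ∈ I \ J → p'.1 ≤ p.1 := by
        intro p p' l hz hz'
        by_contra! hlt
        obtain ⟨hzI, hzJ⟩ := Finset.mem_sdiff.1 hz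
        obtain ⟨hm, hpl⟩ := Finset.mem_filter.1 hzI
        obtain ⟨hp, hl⟩ := Finset.mem_product.1 hm
        obtain ⟨hm', hpl'⟩ := Finset.mem_filter.1 (Finset.mem_sdiff.1 hz').1
        obtain ⟨hp', -⟩ := Finset.mem_product.1 hm'
        dsimp only at *
        obtain ⟨v, hv, hvmin⟩ := (P.filter fun v => p.1 < v.1 ∧
          l.1 * v.1 + l.2 = v.2).exists_min_image Prod.fst ⟨p', Finset.mem_filter.2 ⟨hp', hlt, hpl'⟩⟩
        simp only [Finset.mem_filter] at hv hvmin
        refine hzJ (Finset.mem_image.2 ⟨⟨l, p, v⟩, mem_consecutive.2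
          ⟨⟨hl, hp, hv.1⟩, hpl, hv.2.2, hv.2.1, ?_⟩, rfl⟩)
        intro w hw hw1 hw2 hw3
        exact absurd (hvmin w ⟨hw, hw1, hw3⟩) (not_le.2 hw2)
      rintro ⟨p, l⟩ hz ⟨p', l'⟩ hz' heq
      dsimp only at heq
      subst heq
      have hmem : ∀ {p}, (p, l) ∈ I \ J → p ∈ P := fun h =>
        (Finset.mem_product.1 (Finset.mem_filter.1 (Finset.mem_sdiff.1 h).1).1).1
      rw [hP (hmem hz) (hmem hz') (le_antisymm (key _ _ _ hz' hz) (key _ _ _ hz hz'))]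
  have h3 := Finset.card_le_card_sdiff_add_card (s := I) (t := J)
  omega

/-- A bound of Szemerédi and Trotter for points that lie on at least `k` of the given lines, for
points with different abscissas and non-vertical lines. -/
theorem mul_card_le_of_rich {P L : Finset (ℝ × ℝ)} {k : ℝ}
    (hP : Set.InjOn Prod.fst (P : Set (ℝ × ℝ))) (hk : 8 ≤ k)
    (hrich : ∀ p ∈ P, k ≤ ((L.filter fun l => l.1 * p.1 + l.2 = p.2).card : ℝ)) :
    k * (P.card : ℝ) ≤ 2 * L.card + 128 * (L.card : ℝ) ^ 2 / k ^ 2 := by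
  have hk0 : 0 < k := by linarith
  -- With this sampling probability the term in `P.card` is half of the left-hand side.
  have hs := (isDrawing_consecutive L hP).sampled_card_le (q := 8 / k) (by positivity)
    ((div_le_one hk0).2 hk)
  have hc : ((crossings (consecutive P L)).card : ℝ) ≤ (L.card : ℝ) ^ 2 := by
    exact_mod_cast card_crossings_consecutive_le L hP
  have hi : ∑ p ∈ P, ((L.filter fun l => l.1 * p.1 + l.2 = p.2).card : ℝ) ≤
      (consecutive P L).card + L.card := by
    exact_mod_cast sum_card_filter_le_card_consecutive L hP
  have hkP : k * (P.card : ℝ) ≤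
      ∑ p ∈ P, ((L.filter fun l => l.1 * p.1 + l.2 = p.2).card : ℝ) := by
    rw [mul_comm, ← nsmul_eq_mul]
    exact Finset.card_nsmul_le_sum _ _ _ hrich
  have hE : ((consecutive P L).card : ℝ) ≤ k * P.card / 2 + 64 * (L.card : ℝ) ^ 2 / k ^ 2 := by
    have h4 : (8 / k) ^ 4 * ((crossings (consecutive P L)).card : ℝ) ≤
        (8 / k) ^ 4 * (L.card : ℝ) ^ 2 := mul_le_mul_of_nonneg_left hc (by positivity)
    have h5 : (8 / k) ^ 2 * ((consecutive P L).card : ℝ) ≤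
        (8 / k) ^ 2 * (k * P.card / 2 + 64 * (L.card : ℝ) ^ 2 / k ^ 2) := by
      refine hs.trans ((add_le_add_right h4 _).trans_eq ?_)
      field_simp
      ring
    exact le_of_mul_le_mul_left h5 (by positivity)
  have h6 : 128 * (L.card : ℝ) ^ 2 / k ^ 2 = 2 * (64 * (L.card : ℝ) ^ 2 / k ^ 2) := by ring
  rw [h6]
  linarith

/-! ### Summing over the multiplicities -/

theorem sq_le_sq_add_sum_Ioc (K a : ℕ) : a ^ 2 ≤ K ^ 2 + ∑ k ∈ Finset.Ioc K a, 2 * k := by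
  rcases le_total a K with h | h
  · exact (Nat.pow_le_pow_left h 2).trans (Nat.le_add_right _ _)
  · induction a, h using Nat.le_induction with
    | base => exact Nat.le_add_right _ _
    | succ m hm ih =>
      rw [← Finset.insert_Ioc_right_eq_Ioc_add_one hm, Finset.sum_insert (by simp)]
      nlinarith

/-- If few points are rich in the sense of Szemerédi and Trotter and no multiplicity reaches
`n / 100`, then the multiplicities above `1024` contribute less than a third of `n ^ 2` to the sum
of the squares. -/
theorem sum_sq_le_of_rich_bound {α : Type*} {P : Finset α} {a : α → ℕ} {n : ℝ} (hn : 0 ≤ n)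
    (hrich : ∀ k : ℕ, 8 ≤ k →
      (k : ℝ) * ((P.filter fun p => k ≤ a p).card : ℝ) ≤ 2 * n + 128 * n ^ 2 / (k : ℝ) ^ 2)
    (ha : ∀ p ∈ P, (a p : ℝ) < n / 100) :
    ∑ p ∈ P, (a p : ℝ) ^ 2 ≤ 1024 ^ 2 * (P.card : ℝ) + 29 / 100 * n ^ 2 := by
  set N := ⌊n / 100⌋₊ with hN
  have hpt : ∀ p ∈ P, (a p : ℝ) ^ 2 ≤
      1024 ^ 2 + ∑ k ∈ Finset.Ioc 1024 N, if k ≤ a p then 2 * (k : ℝ) else 0 := by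
    intro p hp
    have h1 : ((a p : ℝ)) ^ 2 ≤ 1024 ^ 2 + ∑ k ∈ Finset.Ioc 1024 (a p), 2 * (k : ℝ) := by
      exact_mod_cast sq_le_sq_add_sum_Ioc 1024 (a p)
    refine h1.trans (add_le_add_right ?_ _)
    rw [← Finset.sum_filter]
    refine Finset.sum_le_sum_of_subset_of_nonneg ?_ fun k _ _ => by positivity
    intro k hk
    obtain ⟨hk1, hk2⟩ := Finset.mem_Ioc.1 hk
    exact Finset.mem_filter.2
      ⟨Finset.mem_Ioc.2 ⟨hk1, hk2.trans (Nat.le_floor (ha p hp).le)⟩, hk2⟩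
  refine (Finset.sum_le_sum hpt).trans ?_
  rw [Finset.sum_add_distrib, Finset.sum_const, nsmul_eq_mul, mul_comm, Finset.sum_comm]
  refine add_le_add_right ?_ _
  have hk : ∀ k ∈ Finset.Ioc 1024 N, (∑ p ∈ P, if k ≤ a p then 2 * (k : ℝ) else 0) ≤
      4 * n + 256 * n ^ 2 * ((k : ℝ) ^ 2)⁻¹ := by
    intro k hk
    have h8 := hrich k (by have := (Finset.mem_Ioc.1 hk).1; omega)
    rw [← Finset.sum_filter, Finset.sum_const, nsmul_eq_mul]
    rw [div_eq_mul_inv] at h8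
    linarith
  refine (Finset.sum_le_sum hk).trans ?_
  rw [Finset.sum_add_distrib, Finset.sum_const, nsmul_eq_mul, Nat.card_Ioc, ← Finset.mul_sum]
  have hNn : (N : ℝ) ≤ n / 100 := Nat.floor_le (by positivity)
  have h1 : ((N - 1024 : ℕ) : ℝ) ≤ n / 100 :=
    (Nat.cast_le.2 (Nat.sub_le _ _)).trans hNn
  have h2 : ∑ k ∈ Finset.Ioc 1024 N, ((k : ℝ) ^ 2)⁻¹ ≤ 1 / 1024 := by
    rcases le_total N 1024 with h | h
    · rw [Finset.Ioc_eq_empty_of_le h, Finset.sum_empty]; norm_num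
    · have := sum_Ioc_inv_sq_le_sub (α := ℝ) (k := 1024) (by norm_num) h
      have h0 : (0 : ℝ) ≤ (N : ℝ)⁻¹ := by positivity
      push_cast at this
      linarith
  have h3 : ((N - 1024 : ℕ) : ℝ) * (4 * n) ≤ n / 100 * (4 * n) :=
    mul_le_mul_of_nonneg_right h1 (by positivity)
  have h4 := mul_le_mul_of_nonneg_left h2 (show 0 ≤ 256 * n ^ 2 by positivity)
  linarith

/-! ### From lines of the Euclidean plane to coordinates -/

/-- Some shear makes none of finitely many given nonzero vectors vertical. -/
theorem exists_shear (D : Finset (Space 2)) (hD : ∀ d ∈ D, d ≠ 0) :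
    ∃ τ : ℝ, ∀ d ∈ D, d 0 + τ * d 1 ≠ 0 := by
  classical
  obtain ⟨τ, hτ⟩ := Infinite.exists_notMem_finset (D.image fun d => -d 0 / d 1)
  refine ⟨τ, fun d hd h => ?_⟩
  by_cases h1 : d 1 = 0
  · refine hD d hd ?_
    rw [h1] at h
    ext i
    fin_cases i
    · simpa using h
    · simpa using h1
  · refine hτ (Finset.mem_image.2 ⟨d, hd, ?_⟩)
    rw [div_eq_iff h1]
    linarith

theorem exists_point_direction {P : AffineSubspace ℝ (Space 2)} (hP : IsAffineHyperplane P) :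
    ∃ q d : Space 2, d ≠ 0 ∧ ∀ p, p ∈ P ↔ ∃ t : ℝ, p = q + t • d := by
  obtain ⟨⟨q, hq⟩, hd⟩ := hP
  obtain ⟨d, hd0, hd1⟩ := finrank_eq_one_iff'.1 (show Module.finrank ℝ P.direction = 1 by omega)
  refine ⟨q, d, by simpa using hd0, fun p => ⟨fun hp => ?_, ?_⟩⟩
  · obtain ⟨t, ht⟩ := hd1 ⟨p -ᵥ q, AffineSubspace.vsub_mem_direction hp hq⟩
    have ht' : t • (d : Space 2) = p - q := congrArg Subtype.val ht
    exact ⟨t, by rw [ht']; abel⟩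
  · rintro ⟨t, rfl⟩
    have := AffineSubspace.vadd_mem_of_mem_direction (P.direction.smul_mem t d.2) hq
    rwa [vadd_eq_add, add_comm] at this

/-- In sheared coordinates a line that the shear does not make vertical is a graph. -/
theorem exists_slope_icpt {P : AffineSubspace ℝ (Space 2)} {q d : Space 2} {τ : ℝ}
    (hP : ∀ p, p ∈ P ↔ ∃ t : ℝ, p = q + t • d) (hd : d 0 + τ * d 1 ≠ 0) :
    ∃ l : ℝ × ℝ, ∀ p : Space 2, p ∈ P ↔ l.1 * (p 0 + τ * p 1) + l.2 = p 1 := by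
  refine ⟨(d 1 / (d 0 + τ * d 1), q 1 - d 1 / (d 0 + τ * d 1) * (q 0 + τ * q 1)), fun p => ?_⟩
  rw [hP]
  constructor
  · rintro ⟨t, rfl⟩
    simp only [PiLp.add_apply, PiLp.smul_apply, smul_eq_mul]
    linear_combination t * div_mul_cancel₀ (d 1) hd
  · intro h
    dsimp only at h
    set t := ((p 0 + τ * p 1) - (q 0 + τ * q 1)) / (d 0 + τ * d 1) with ht
    have h1 : p 1 = q 1 + t * d 1 := by
      rw [← h, ht]
      field_simp
      ring
    have h0 : p 0 + τ * p 1 = q 0 + τ * q 1 + t * (d 0 + τ * d 1) := by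
      rw [ht, div_mul_cancel₀ _ hd]
      ring
    refine ⟨t, ?_⟩
    ext i
    fin_cases i
    · simp only [Fin.zero_eta, PiLp.add_apply, PiLp.smul_apply, smul_eq_mul]
      rw [h1] at h0
      linarith
    · simpa using h1

open Classical in
/-- A bound of Szemerédi and Trotter for the points of the Euclidean plane that lie on at least `k`
of finitely many lines. -/
theorem IsArrangement.mul_card_le_of_rich {H : Finset (AffineSubspace ℝ (Space 2))}
    (hH : IsArrangement H) (P : Finset (Space 2)) {k : ℝ} (hk : 8 ≤ k)
    (hrich : ∀ p ∈ P, k ≤ ((H.filter fun l => p ∈ l).card : ℝ)) :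
    k * (P.card : ℝ) ≤ 2 * H.card + 128 * (H.card : ℝ) ^ 2 / k ^ 2 := by
  choose! q d hd hqd using fun l hl => exists_point_direction (hH l hl)
  obtain ⟨τ, hτ⟩ := exists_shear
    (H.image d ∪ ((P ×ˢ P).filter fun z => z.1 ≠ z.2).image fun z => z.1 - z.2) (by
      intro v hv
      rcases Finset.mem_union.1 hv with hv | hv
      · obtain ⟨l, hl, rfl⟩ := Finset.mem_image.1 hv
        exact hd l hl
      · obtain ⟨z, hz, rfl⟩ := Finset.mem_image.1 hv
        exact sub_ne_zero.2 (Finset.mem_filter.1 hz).2)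
  choose! g hg using fun l hl => exists_slope_icpt (hqd l hl)
    (hτ _ (Finset.mem_union_left _ (Finset.mem_image_of_mem d hl)))
  set φ : Space 2 → ℝ × ℝ := fun p => (p 0 + τ * p 1, p 1) with hφ
  have hφP : ∀ p ∈ P, ∀ p' ∈ P, (φ p).1 = (φ p').1 → p = p' := by
    intro p hp p' hp' heq
    by_contra hne
    refine hτ (p - p') (Finset.mem_union_right _ (Finset.mem_image.2
      ⟨(p, p'), Finset.mem_filter.2 ⟨Finset.mk_mem_product hp hp', hne⟩, rfl⟩)) ?_
    simp only [hφ] at heq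
    simp only [PiLp.sub_apply]
    linarith
  have hginj : Set.InjOn g (H : Set (AffineSubspace ℝ (Space 2))) := by
    intro l hl l' hl' heq
    ext p
    rw [hg l hl, hg l' hl', heq]
  have hcardP : (P.image φ).card = P.card :=
    Finset.card_image_of_injOn fun p hp p' hp' heq => hφP p hp p' hp' (congrArg Prod.fst heq)
  have hcardH : (H.image g).card = H.card := Finset.card_image_of_injOn hginj
  rw [← hcardP, ← hcardH]
  refine _root_.mul_card_le_of_rich ?_ hk ?_
  · intro x hx y hy hxy
    obtain ⟨p, hp, rfl⟩ := Finset.mem_image.1 hx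
    obtain ⟨p', hp', rfl⟩ := Finset.mem_image.1 hy
    rw [hφP p hp p' hp' hxy]
  · intro x hx
    obtain ⟨p, hp, rfl⟩ := Finset.mem_image.1 hx
    refine (hrich p hp).trans (Nat.cast_le.2 ?_)
    refine Finset.card_le_card_of_injOn g ?_ (hginj.mono fun l hl => (Finset.mem_filter.1 hl).1)
    intro l hl
    obtain ⟨hl, hpl⟩ := Finset.mem_filter.1 hl
    exact Finset.mem_coe.2 (Finset.mem_filter.2
      ⟨Finset.mem_image_of_mem g hl, (hg l hl p).1 hpl⟩)

/-! ### Two families of lines -/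

open Classical in
theorem hyperplanesThrough_singleton {d : ℕ} (H : Finset (AffineSubspace ℝ (Space d)))
    (p : Space d) : hyperplanesThrough H {p} = (H.filter fun l => p ∈ l).card := by
  rw [hyperplanesThrough, ← Set.ncard_coe_finset]
  congr 1
  ext l
  simp

/-- A point of `B` that is the only common point of two lines of `H` is a flat of dimension `0`. -/
theorem card_le_ncard_flatsMeeting_zero {d : ℕ} {H : Finset (AffineSubspace ℝ (Space d))}
    {B : Set (Space d)} (P : Finset (Space d)) (hPB : ∀ p ∈ P, p ∈ B)
    (hP : ∀ p ∈ P, ∃ f ∈ H, ∃ g ∈ H, (f : Set (Space d)) ∩ g = {p}) :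
    P.card ≤ (flatsMeeting H 0 B).ncard := by
  classical
  set ψ : Space d → AffineSubspace ℝ (Space d) := fun p => AffineSubspace.mk' p ⊥ with hψ
  have hcoe : ∀ p, (ψ p : Set (Space d)) = {p} := by
    intro p
    ext x
    simp [hψ, AffineSubspace.mem_mk', sub_eq_zero]
  rw [← Set.ncard_coe_finset]
  refine Set.ncard_le_ncard_of_injOn ψ ?_ ?_ (flatsMeeting_finite H 0 B)
  · intro p hp
    obtain ⟨f, hf, g, hg, hfg⟩ := hP p hp
    refine ⟨⟨by rw [hcoe]; exact Set.singleton_nonempty p, {f, g}, ?_, ?_⟩, ?_, p, ?_, hPB p hp⟩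
    · simp [Finset.insert_subset_iff, hf, hg]
    · apply SetLike.coe_injective
      rw [hcoe, ← hfg, Finset.coe_pair, sInf_pair]
      rfl
    · simp [hψ]
    · rw [hcoe]; rfl
  · intro p _ p' _ heq
    have := congrArg (fun s : AffineSubspace ℝ (Space d) => (s : Set (Space d))) heq
    simpa only [hcoe, Set.singleton_eq_singleton_iff] using this

/-- Two lines of the plane with two common points are equal. -/
theorem IsAffineHyperplane.eq_of_mem {f g : AffineSubspace ℝ (Space 2)}
    (hf : IsAffineHyperplane f) (hg : IsAffineHyperplane g) {p q : Space 2} (hpq : p ≠ q)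
    (hpf : p ∈ f) (hpg : p ∈ g) (hqf : q ∈ f) (hqg : q ∈ g) : f = g := by
  have key : ∀ {l : AffineSubspace ℝ (Space 2)}, IsAffineHyperplane l → p ∈ l → q ∈ l →
      Submodule.span ℝ {p -ᵥ q} = l.direction := by
    intro l hl hp hq
    refine Submodule.eq_of_le_of_finrank_eq ?_ ?_
    · exact (Submodule.span_singleton_le_iff_mem _ _).2 (AffineSubspace.vsub_mem_direction hp hq)
    · rw [finrank_span_singleton (vsub_ne_zero.2 hpq)]
      have := hl.2
      omega
  exact AffineSubspace.ext_of_direction_eq ((key hf hpf hqf).symm.trans (key hg hpg hqg))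
    ⟨p, hpf, hpg⟩

open Classical in
/-- If `P` contains, for every pair of `F₁ × F₂`, a point on both of its lines, then the number of
pairs is at most a quarter of the sum of the squared multiplicities. -/
theorem four_mul_card_mul_card_le_sum_sq {d : ℕ} {F₁ F₂ : Finset (AffineSubspace ℝ (Space d))}
    (hdisj : Disjoint F₁ F₂) {P : Finset (Space d)}
    (hP : ∀ f ∈ F₁, ∀ g ∈ F₂, ∃ p ∈ P, p ∈ f ∧ p ∈ g) :
    4 * (F₁.card * F₂.card) ≤ ∑ p ∈ P, ((F₁ ∪ F₂).filter fun l => p ∈ l).card ^ 2 := by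
  have hsub : F₁ ×ˢ F₂ ⊆
      P.biUnion fun p => (F₁.filter fun l => p ∈ l) ×ˢ (F₂.filter fun l => p ∈ l) := by
    rintro ⟨f, g⟩ hfg
    obtain ⟨hf, hg⟩ := Finset.mem_product.1 hfg
    obtain ⟨p, hp, hpf, hpg⟩ := hP f hf g hg
    exact Finset.mem_biUnion.2 ⟨p, hp, Finset.mk_mem_product
      (Finset.mem_filter.2 ⟨hf, hpf⟩) (Finset.mem_filter.2 ⟨hg, hpg⟩)⟩
  have hle := (Finset.card_le_card hsub).trans Finset.card_biUnion_le
  rw [Finset.card_product] at hle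
  refine (Nat.mul_le_mul_left 4 hle).trans ?_
  rw [Finset.mul_sum]
  refine Finset.sum_le_sum fun p _ => ?_
  rw [Finset.card_product, Finset.filter_union,
    Finset.card_union_of_disjoint (Finset.disjoint_filter_filter hdisj), ← mul_assoc]
  exact four_mul_le_sq_add _ _

theorem mainTheorem7 :
    ∃ c₂ : ℝ, 0 < c₂ ∧
      ∀ (n : ℕ) (H F₁ F₂ : Finset (AffineSubspace ℝ (Space 2))) (B : Set (Space 2)),
        IsArrangement H →
        (H : Set (AffineSubspace ℝ (Space 2))) = ↑F₁ ∪ ↑F₂ →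
        Disjoint F₁ F₂ →
        (F₁.card : ℝ) = (n : ℝ) / 2 →
        (F₂.card : ℝ) = (n : ℝ) / 2 →
        Convex ℝ B →
        (∀ f ∈ F₁, ∀ g ∈ F₂, ∃ p ∈ B, B ∩ (f : Set (Space 2)) ∩ (g : Set (Space 2)) = {p}) →
        (∃ p ∈ B, (n : ℝ) / 100 ≤ (hyperplanesThrough H {p} : ℝ)) ∨
          c₂ * (n : ℝ) ^ 2 ≤ ((flatsMeeting H 0 B).ncard : ℝ) := by
  classical
  refine ⟨1 / (2 * 1024 ^ 2), by norm_num, ?_⟩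
  intro n H F₁ F₂ B hH hHF hdisj hc₁ hc₂ _ hcross
  have hHF' : H = F₁ ∪ F₂ := Finset.coe_injective (hHF.trans (Finset.coe_union F₁ F₂).symm)
  have hcardH : (H.card : ℝ) = n := by
    rw [hHF', Finset.card_union_of_disjoint hdisj]
    push_cast
    linarith
  refine or_iff_not_imp_left.2 fun hno => ?_
  push Not at hno
  choose! pt hptB hpt using hcross
  have hmem : ∀ f ∈ F₁, ∀ g ∈ F₂, pt f g ∈ f ∧ pt f g ∈ g := by
    intro f hf g hg
    have h : pt f g ∈ B ∩ (f : Set (Space 2)) ∩ g := by rw [hpt f hf g hg]; rfl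
    exact ⟨h.1.2, h.2⟩
  set P := (F₁ ×ˢ F₂).image fun z => pt z.1 z.2 with hP
  have hPB : ∀ p ∈ P, p ∈ B := by
    intro p hp
    obtain ⟨z, hz, rfl⟩ := Finset.mem_image.1 hp
    obtain ⟨hf, hg⟩ := Finset.mem_product.1 hz
    exact hptB _ hf _ hg
  have hflats : P.card ≤ (flatsMeeting H 0 B).ncard := by
    refine card_le_ncard_flatsMeeting_zero P hPB fun p hp => ?_
    obtain ⟨⟨f, g⟩, hz, rfl⟩ := Finset.mem_image.1 hp
    obtain ⟨hf, hg⟩ := Finset.mem_product.1 hz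
    obtain ⟨hpf, hpg⟩ := hmem f hf g hg
    have hfH : f ∈ H := hHF' ▸ Finset.mem_union_left _ hf
    have hgH : g ∈ H := hHF' ▸ Finset.mem_union_right _ hg
    refine ⟨f, hfH, g, hgH, Set.Subset.antisymm (fun q hq => ?_) ?_⟩
    · by_contra hne
      have hfg := (hH f hfH).eq_of_mem (hH g hgH) (Ne.symm hne) hpf hpg hq.1 hq.2
      exact Finset.disjoint_left.1 hdisj hf (hfg ▸ hg)
    · rintro _ rfl
      exact ⟨hpf, hpg⟩
  have hpairs : (n : ℝ) ^ 2 ≤ ∑ p ∈ P, ((H.filter fun l => p ∈ l).card : ℝ) ^ 2 := by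
    have h : 4 * (F₁.card * F₂.card) ≤ ∑ p ∈ P, (H.filter fun l => p ∈ l).card ^ 2 := by
      rw [hHF']
      exact four_mul_card_mul_card_le_sum_sq hdisj fun f hf g hg => ⟨pt f g,
        Finset.mem_image.2 ⟨(f, g), Finset.mk_mem_product hf hg, rfl⟩, hmem f hf g hg⟩
    have h' : (4 * (F₁.card * F₂.card) : ℝ) ≤
        ∑ p ∈ P, ((H.filter fun l => p ∈ l).card : ℝ) ^ 2 := by exact_mod_cast h
    refine le_trans (le_of_eq ?_) h'
    rw [hc₁, hc₂]
    ring
  have hsum := sum_sq_le_of_rich_bound (P := P) (a := fun p => (H.filter fun l => p ∈ l).card)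
    (n := n) (Nat.cast_nonneg n) (fun k hk => by
      rw [← hcardH]
      exact hH.mul_card_le_of_rich _ (by exact_mod_cast hk) fun p hp => by
        exact_mod_cast (Finset.mem_filter.1 hp).2)
    (fun p hp => by
      rw [← hyperplanesThrough_singleton]
      exact hno p (hPB p hp))
  have hfl : (P.card : ℝ) ≤ ((flatsMeeting H 0 B).ncard : ℝ) := by exact_mod_cast hflats
  refine le_trans ?_ hfl
  have := sq_nonneg (n : ℝ)
  linarith
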